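/- Let $m\ge 3$ be an odd integer, let $\chi(x)=e^{\frac{2\pi i}{3}\operatorname{Tr}(x)}$ be the canonical additive character of $\mathbb F_{3^m}$, where $\operatorname{Tr}$ denotes the trace from $\mathbb F_{3^m}$ to $\mathbb F_3$, and for $a,b\in\mathbb F_{3^m}$ let $$K_m(a,b)=\sum_{x\in\mathbb F_{3^m}^*}\chi(ax+bx^{-1})$$ be the Kloosterman sum. Then for all $a,b\in\mathbb F_{3^m}$ with $(a,b)\ne(0,0)$, the number $K_m(a,b)$ is real and $$K_m(a,b)\le\frac{3^m+2\cdot 3^{m-1}-1}{4}.$$ -/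

import Mathlib

/-- The canonical additive character `χ(x) = ζ_p ^ Tr(x)` of a finite field `F` of
characteristic `p`, where `ζ_p = exp(2πi/p)` and `Tr` is the trace from `F` to the prime field.
The exponent, an element of `ZMod p`, is represented by its residue in `{0, …, p - 1}`. -/
noncomputable def canonicalAddChar (p : ℕ) (F : Type*) [Field F] [Algebra (ZMod p) F]
    (x : F) : ℂ :=
  Complex.exp (2 * Real.pi * Complex.I / p) ^ (Algebra.trace (ZMod p) F x).val

/-- The Kloosterman sum `∑_{x ∈ Fˣ} χ(a x + b x⁻¹)` over a finite field `F` of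
characteristic `p`, where `χ` is the canonical additive character of `F`. -/
noncomputable def kloostermanSum (p : ℕ) (F : Type*) [Field F] [Fintype F] [DecidableEq F]
    [Algebra (ZMod p) F] (a b : F) : ℂ :=
  ∑ x : Fˣ, canonicalAddChar p F (a * (x : F) + b * (x : F)⁻¹)

open Finset

/-! Fourth moment method, with `q = 3 ^ m`. By orthogonality, the sum of `K(a,b)^4` over all pairs
is `q^2` times the number of unit solutions of `x+y+z+w = 0 = x⁻¹+y⁻¹+z⁻¹+w⁻¹`, which is at most
`(q-1)(3q-5)`. Removing `K(0,0)^4 = (q-1)^4` and using that `K` is constant on the `q-1` pairs `(ta,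
t⁻¹b)` gives `K^4 ≤ 2q^3-2q^2-3q+1`. This suffices for `q ≥ 81`; `q = 27` also needs `K ≡ q-1 (mod
3)`. -/

lemma exp_two_pi_div_three_pow_three :
    Complex.exp (2 * Real.pi * Complex.I / (3 : ℕ)) ^ 3 = 1 :=
  (Complex.isPrimitiveRoot_exp 3 (by norm_num)).pow_eq_one

lemma one_add_exp_add_exp_sq :
    1 + Complex.exp (2 * Real.pi * Complex.I / (3 : ℕ)) +
      Complex.exp (2 * Real.pi * Complex.I / (3 : ℕ)) ^ 2 = 0 := by
  have h := (Complex.isPrimitiveRoot_exp 3 (by norm_num)).geom_sum_eq_zero (by norm_num)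
  simpa [Finset.sum_range_succ] using h

section

variable (F : Type*) [Field F] [Algebra (ZMod 3) F]

/-- The canonical additive character in characteristic three, as a bundled `AddChar`. -/
noncomputable def ternaryAddChar : AddChar F ℂ :=
  (AddChar.zmodChar 3 exp_two_pi_div_three_pow_three).compAddMonoidHom
    (Algebra.trace (ZMod 3) F).toAddMonoidHom

lemma ternaryAddChar_apply (x : F) : ternaryAddChar F x = canonicalAddChar 3 F x := rfl

lemma ternaryAddChar_isPrimitive [Fintype F] : (ternaryAddChar F).IsPrimitive := by
  apply AddChar.IsPrimitive.of_ne_one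
  rw [AddChar.ne_one_iff]
  obtain ⟨x, hx⟩ := Algebra.trace_surjective (ZMod 3) F 1
  refine ⟨x, ?_⟩
  rw [ternaryAddChar_apply, canonicalAddChar, hx]
  have : (1 : ZMod 3).val = 1 := rfl
  rw [this, pow_one]
  exact (Complex.isPrimitiveRoot_exp 3 (by norm_num)).ne_one (by norm_num)

/-! ### Values and symmetry of the sums -/

variable {F} [Fintype F] [DecidableEq F]

/-- The substitution `x ↦ -x` shows that traces 1 and 2 occur equally often, `n` times each; since
`1 + ζ + ζ² = 0`, each such pair of terms contributes `-1`. -/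
lemma kloostermanSum_eq_card_sub (a b : F) :
    ∃ n : ℕ, kloostermanSum 3 F a b = ((Fintype.card F : ℝ) - 1 - 3 * n : ℝ) := by
  set t : Fˣ → ZMod 3 := fun x => Algebra.trace (ZMod 3) F (a * (x : F) + b * (x : F)⁻¹) with ht
  set N : ZMod 3 → ℕ := fun i => #{x : Fˣ | t x = i} with hN
  have hneg : N 2 = N 1 := by
    refine Finset.card_bij (fun x _ => -x) ?_ ?_ ?_
    · intro x hx
      simp only [mem_filter, mem_univ, true_and] at hx ⊢
      have : t (-x) = - t x := by
        simp only [ht, Units.val_neg, inv_neg, ← map_neg]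
        congr 1; ring
      rw [this, hx]; decide
    · intro x _ y _ h; exact neg_injective h
    · intro x hx
      refine ⟨-x, ?_, neg_neg x⟩
      simp only [mem_filter, mem_univ, true_and] at hx ⊢
      have : t (-x) = - t x := by
        simp only [ht, Units.val_neg, inv_neg, ← map_neg]
        congr 1; ring
      rw [this, hx]; decide
  have hcard : N 0 + N 1 + N 2 = Fintype.card F - 1 := by
    rw [← Fintype.card_units, ← Finset.card_univ,
      Finset.card_eq_sum_card_fiberwise (f := t) (t := univ) (fun _ _ => mem_univ _)]
    exact (Fin.sum_univ_three N).symm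
  have hsum : kloostermanSum 3 F a b = N 0 +
      N 1 * Complex.exp (2 * Real.pi * Complex.I / (3 : ℕ)) +
      N 2 * Complex.exp (2 * Real.pi * Complex.I / (3 : ℕ)) ^ 2 := by
    have h1 : kloostermanSum 3 F a b =
        ∑ i : ZMod 3, N i * Complex.exp (2 * Real.pi * Complex.I / (3 : ℕ)) ^ i.val := by
      rw [kloostermanSum, ← Finset.sum_fiberwise univ t]
      refine Finset.sum_congr rfl fun i _ => ?_
      rw [Finset.sum_congr rfl (g := fun _ =>
        Complex.exp (2 * Real.pi * Complex.I / (3 : ℕ)) ^ i.val)]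
      · rw [Finset.sum_const, nsmul_eq_mul]
      · intro x hx
        rw [canonicalAddChar, ← (mem_filter.mp hx).2]
    rw [h1]
    refine (Fin.sum_univ_three (fun i : ZMod 3 => (N i : ℂ) *
      Complex.exp (2 * Real.pi * Complex.I / (3 : ℕ)) ^ i.val)).trans ?_
    have e0 : (0 : ZMod 3).val = 0 := rfl
    have e1 : (1 : ZMod 3).val = 1 := rfl
    have e2 : (2 : ZMod 3).val = 2 := rfl
    change (N 0 : ℂ) * _ ^ (0 : ZMod 3).val + (N 1 : ℂ) * _ ^ (1 : ZMod 3).val +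
      (N 2 : ℂ) * _ ^ (2 : ZMod 3).val = _
    rw [e0, e1, e2, pow_zero, pow_one, mul_one]
  refine ⟨N 1, ?_⟩
  have hpos : 1 ≤ Fintype.card F := Fintype.card_pos
  have hc : (N 0 : ℂ) + N 1 + N 2 = Fintype.card F - 1 := by
    have := congrArg (Nat.cast (R := ℂ)) hcard
    push_cast [Nat.cast_sub hpos] at this
    exact this
  rw [hsum, hneg]
  rw [hneg] at hc
  push_cast
  linear_combination hc + (N 1 : ℂ) * one_add_exp_add_exp_sq

lemma kloostermanSum_mul_units (a b : F) (t : Fˣ) :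
    kloostermanSum 3 F (t * a) ((t : F)⁻¹ * b) = kloostermanSum 3 F a b := by
  rw [kloostermanSum, kloostermanSum]
  refine Fintype.sum_equiv (Equiv.mulLeft t) _ _ fun x => ?_
  rw [Equiv.coe_mulLeft, Units.val_mul, mul_inv]
  congr 1; ring

lemma kloostermanSum_zero_zero :
    kloostermanSum 3 F 0 0 = (Fintype.card F : ℂ) - 1 := by
  have hpos : 1 ≤ Fintype.card F := Fintype.card_pos
  simp [kloostermanSum, canonicalAddChar, Fintype.card_units, Nat.cast_sub hpos]

/-! ### The fourth moment -/

omit [Algebra (ZMod 3) F]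

/-- Either `x + y = 0 = z + w` (set `A`), or `xy = zw`, so that `{z, w} = {-x, -y}` (sets `B` and
`C`). -/
lemma card_units_sum_eq_zero_sum_inv_eq_zero_le :
    #{p : (Fˣ × Fˣ) × (Fˣ × Fˣ) |
      (p.1.1 : F) + p.1.2 + (p.2.1 + p.2.2) = 0 ∧
      (p.1.1 : F)⁻¹ + (p.1.2 : F)⁻¹ + ((p.2.1 : F)⁻¹ + (p.2.2 : F)⁻¹) = 0} ≤
    (Fintype.card F - 1) * (3 * Fintype.card F - 5) := by
  set A : Finset ((Fˣ × Fˣ) × (Fˣ × Fˣ)) :=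
    (univ : Finset (Fˣ × Fˣ)).image fun p => ((p.1, -p.1), (p.2, -p.2)) with hA
  set S : Finset (Fˣ × Fˣ) := {p | p.2 ≠ -p.1} with hS
  set B : Finset ((Fˣ × Fˣ) × (Fˣ × Fˣ)) := S.image fun p => (p, (-p.1, -p.2)) with hB
  set C : Finset ((Fˣ × Fˣ) × (Fˣ × Fˣ)) := S.image fun p => (p, (-p.2, -p.1)) with hC
  have hScard : #S = (Fintype.card F - 1) * (Fintype.card F - 2) := by
    have h1 : #({p | p.2 = -p.1} : Finset (Fˣ × Fˣ)) = Fintype.card Fˣ := by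
      rw [← Finset.card_univ]
      refine (Finset.card_bij (fun x _ => (x, -x)) ?_ ?_ ?_).symm
      · simp
      · intro x _ y _ h; exact congrArg Prod.fst h
      · rintro ⟨x, y⟩ h
        exact ⟨x, mem_univ _, by simp at h; simp [h]⟩
    have h2 := Finset.card_filter_add_card_filter_not (s := (univ : Finset (Fˣ × Fˣ)))
      (fun p => p.2 = -p.1)
    rw [h1, Finset.card_univ, Fintype.card_prod, Fintype.card_units] at h2
    have h3 : 1 < Fintype.card F := Fintype.one_lt_card
    change _ + #S = _ at h2
    -- Writing `q = 2 + k` removes the truncated subtractions.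
    obtain ⟨k, hk⟩ := Nat.exists_eq_add_of_le h3
    rw [hk] at h2 ⊢
    have e1 : Nat.succ 1 + k - 1 = k + 1 := by omega
    have e2 : Nat.succ 1 + k - 2 = k := by omega
    rw [e1] at h2 ⊢
    rw [e2]
    nlinarith
  have hsub : ({p : (Fˣ × Fˣ) × (Fˣ × Fˣ) |
      (p.1.1 : F) + p.1.2 + (p.2.1 + p.2.2) = 0 ∧
      (p.1.1 : F)⁻¹ + (p.1.2 : F)⁻¹ + ((p.2.1 : F)⁻¹ + (p.2.2 : F)⁻¹) = 0} :
      Finset _) ⊆ A ∪ (B ∪ C) := by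
    rintro ⟨⟨x, y⟩, ⟨z, w⟩⟩ h
    simp only [mem_filter, mem_univ, true_and] at h
    obtain ⟨h1, h2⟩ := h
    by_cases hxy : y = -x
    · refine mem_union_left _ (mem_image.mpr ⟨(x, z), mem_univ _, ?_⟩)
      have hw : w = -z := by
        ext
        rw [hxy] at h1
        push_cast at h1 ⊢
        linear_combination h1
      rw [hxy, hw]
    · refine mem_union_right _ ?_
      have hs : (x : F) + y ≠ 0 := fun h => hxy (by
        ext; push_cast; linear_combination h)
      have hx := x.ne_zero
      have hy := y.ne_zero
      have hz := z.ne_zero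
      have hw := w.ne_zero
      field_simp at h2
      have h3 : ((x : F) + y) * (z * w - x * y) = 0 := by
        linear_combination h2 - (x : F) * y * h1
      have h4 : (z : F) * w - x * y = 0 := (mul_eq_zero.mp h3).resolve_left hs
      have h5 : ((z : F) + x) * (z + y) = 0 := by
        linear_combination (z : F) * h1 - h4
      rcases mul_eq_zero.mp h5 with h6 | h6
      · refine mem_union_left _ (mem_image.mpr ⟨(x, y), by simpa [hS] using hxy, ?_⟩)
        have e1 : z = -x := by ext; push_cast; linear_combination h6
        have e2 : w = -y := by ext; push_cast; linear_combination h1 - h6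
        rw [e1, e2]
      · refine mem_union_right _ (mem_image.mpr ⟨(x, y), by simpa [hS] using hxy, ?_⟩)
        have e1 : z = -y := by ext; push_cast; linear_combination h6
        have e2 : w = -x := by ext; push_cast; linear_combination h1 - h6
        rw [e1, e2]
  have hAc : #A ≤ (Fintype.card F - 1) * (Fintype.card F - 1) := by
    refine card_image_le.trans ?_
    rw [Finset.card_univ, Fintype.card_prod, Fintype.card_units]
  have hBc : #B ≤ _ := card_image_le.trans hScard.le
  have hCc : #C ≤ _ := card_image_le.trans hScard.le
  have hle := (card_le_card hsub).trans
    ((card_union_le _ _).trans (Nat.add_le_add hAc ((card_union_le _ _).trans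
      (Nat.add_le_add hBc hCc))))
  refine hle.trans ?_
  have h3 : 1 < Fintype.card F := Fintype.one_lt_card
  rw [← mul_add, ← mul_add]
  exact Nat.mul_le_mul_left _ (by omega)

variable [Algebra (ZMod 3) F]

lemma sum_kloostermanSum_pow_four :
    ∑ p : F × F, kloostermanSum 3 F p.1 p.2 ^ 4 = (Fintype.card F : ℂ) ^ 2 *
      #{p : (Fˣ × Fˣ) × (Fˣ × Fˣ) |
        (p.1.1 : F) + p.1.2 + (p.2.1 + p.2.2) = 0 ∧
        (p.1.1 : F)⁻¹ + (p.1.2 : F)⁻¹ + ((p.2.1 : F)⁻¹ + (p.2.2 : F)⁻¹) = 0} := by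
  have hexp (a b : F) : kloostermanSum 3 F a b ^ 4 =
      ∑ p : (Fˣ × Fˣ) × (Fˣ × Fˣ),
        ternaryAddChar F (a * ((p.1.1 : F) + p.1.2 + (p.2.1 + p.2.2))) *
        ternaryAddChar F (b *
          ((p.1.1 : F)⁻¹ + (p.1.2 : F)⁻¹ + ((p.2.1 : F)⁻¹ + (p.2.2 : F)⁻¹))) := by
    have h4 (k : ℂ) : k ^ 4 = (k * k) * (k * k) := by ring
    rw [h4, kloostermanSum, Fintype.sum_mul_sum, ← Fintype.sum_prod_type', Fintype.sum_mul_sum,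
      ← Fintype.sum_prod_type']
    refine Finset.sum_congr rfl fun p _ => ?_
    simp only [← ternaryAddChar_apply, ← AddChar.map_add_eq_mul]
    congr 1; ring
  have hprim := ternaryAddChar_isPrimitive F
  simp only [hexp]
  rw [Finset.sum_comm, Finset.card_filter, Nat.cast_sum, Finset.mul_sum]
  refine Finset.sum_congr rfl fun p _ => ?_
  rw [Fintype.sum_prod_type]
  dsimp only
  rw [← Fintype.sum_mul_sum, AddChar.sum_mulShift _ hprim,
    AddChar.sum_mulShift _ hprim]
  split_ifs <;> simp_all [pow_two]

lemma kloostermanSum_re_pow_four_le {a b : F} (hab : (a, b) ≠ (0, 0)) :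
    (kloostermanSum 3 F a b).re ^ 4 ≤
      (Fintype.card F : ℝ) ^ 2 * (3 * Fintype.card F - 5) - (Fintype.card F - 1) ^ 3 := by
  have hreal (a b : F) : kloostermanSum 3 F a b = ((kloostermanSum 3 F a b).re : ℂ) := by
    obtain ⟨n, hn⟩ := kloostermanSum_eq_card_sub a b
    rw [hn, Complex.ofReal_re]
  set f : F × F → ℝ := fun p => (kloostermanSum 3 F p.1 p.2).re ^ 4 with hf
  have hf0 (p : F × F) : 0 ≤ f p := by positivity
  have hq : 1 < Fintype.card F := Fintype.one_lt_card
  have hq1 : (1 : ℝ) < Fintype.card F := by exact_mod_cast hq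
  have htot : ∑ p, f p ≤ (Fintype.card F : ℝ) ^ 2 *
      ((Fintype.card F - 1) * (3 * Fintype.card F - 5)) := by
    have h := sum_kloostermanSum_pow_four (F := F)
    rw [Finset.sum_congr rfl (g := fun p => ((f p : ℝ) : ℂ)) fun p _ => by
      rw [hreal p.1 p.2, hf, Complex.ofReal_pow]] at h
    rw [← Complex.ofReal_sum, ← Complex.ofReal_natCast, ← Complex.ofReal_natCast (#_),
      ← Complex.ofReal_pow, ← Complex.ofReal_mul, Complex.ofReal_inj] at h
    rw [h]
    refine mul_le_mul_of_nonneg_left ?_ (by positivity)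
    refine (Nat.cast_le.mpr card_units_sum_eq_zero_sum_inv_eq_zero_le).trans (le_of_eq ?_)
    rw [Nat.cast_mul, Nat.cast_sub hq.le, Nat.cast_sub (by omega)]
    push_cast; ring
  -- The orbit of `(a, b)`: `q - 1` distinct nonzero pairs with the same sum.
  set o : Fˣ → F × F := fun t => ((t : F) * a, (t : F)⁻¹ * b) with ho
  have hinj : Function.Injective o := by
    intro s t hst
    obtain ⟨h1, h2⟩ := Prod.mk.inj hst
    by_cases ha : a = 0
    · have hb : b ≠ 0 := fun hb => hab (by rw [ha, hb])
      exact Units.ext (inv_injective (mul_right_cancel₀ hb h2))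
    · exact Units.ext (mul_right_cancel₀ ha h1)
  have hnot : ((0 : F), (0 : F)) ∉ univ.image o := by
    intro h
    obtain ⟨t, -, ht⟩ := mem_image.mp h
    obtain ⟨h1, h2⟩ := Prod.mk.inj ht
    have ht0 := t.ne_zero
    simp only [mul_eq_zero, ht0, inv_eq_zero, false_or] at h1 h2
    exact hab (by rw [h1, h2])
  have horb : ∑ p ∈ univ.image o, f p = (Fintype.card F - 1) * f (a, b) := by
    rw [Finset.sum_image hinj.injOn]
    simp only [hf, ho, kloostermanSum_mul_units, Finset.sum_const, Finset.card_univ,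
      Fintype.card_units, nsmul_eq_mul, Nat.cast_sub hq.le, Nat.cast_one]
  have hzero : f (0, 0) = ((Fintype.card F : ℝ) - 1) ^ 4 := by
    simp [hf, kloostermanSum_zero_zero]
  have hle : ∑ p ∈ insert (0, 0) (univ.image o), f p ≤ ∑ p, f p :=
    Finset.sum_le_univ_sum_of_nonneg hf0
  rw [Finset.sum_insert hnot, horb, hzero] at hle
  have hpos : (0 : ℝ) < Fintype.card F - 1 := by linarith
  change f (a, b) ≤ _
  refine le_of_mul_le_mul_left ?_ hpos
  linarith

end

theorem corollary4p6 (m : ℕ) (hm : Odd m) (hm3 : 3 ≤ m)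
    (F : Type*) [Field F] [Fintype F] [DecidableEq F] [Algebra (ZMod 3) F]
    (hF : Fintype.card F = 3 ^ m) (a b : F) (hab : (a, b) ≠ (0, 0)) :
    (kloostermanSum 3 F a b).im = 0 ∧
      (kloostermanSum 3 F a b).re ≤ ((3 : ℝ) ^ m + 2 * (3 : ℝ) ^ (m - 1) - 1) / 4 := by
  have hb := kloostermanSum_re_pow_four_le hab
  obtain ⟨n, hn⟩ := kloostermanSum_eq_card_sub a b
  refine ⟨by rw [hn, Complex.ofReal_im], ?_⟩
  rw [hn, Complex.ofReal_re] at hb ⊢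
  rw [hF] at hb ⊢
  push_cast at hb ⊢
  rcases hm3.eq_or_lt with rfl | hm4
  · norm_num at hb ⊢
    by_contra! hlt
    -- Here `q = 27`: a value `26 - 3n > 11` is at least 14, but `14^4 = 38416` exceeds the moment
    -- bound 37828.
    have hn4 : n ≤ 4 := by
      by_contra! h5
      have : (5 : ℝ) ≤ n := by exact_mod_cast h5
      linarith
    have : (n : ℝ) ≤ 4 := by exact_mod_cast hn4
    have h14 : (14 : ℝ) ≤ 26 - 3 * n := by linarith
    have := pow_le_pow_left₀ (by norm_num) h14 4
    norm_num at this
    linarith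
  · obtain ⟨k, rfl⟩ := Nat.exists_eq_add_of_le (Nat.succ_le_of_lt hm4)
    have e : Nat.succ 3 + k - 1 = 3 + k := by omega
    rw [e]
    set Q : ℝ := 3 ^ (3 + k) with hQ
    have hq : (3 : ℝ) ^ (Nat.succ 3 + k) = 3 * Q := by rw [hQ]; ring
    rw [hq] at hb ⊢
    have hQ27 : 27 ≤ Q := by
      rw [hQ, pow_add]
      have : (1 : ℝ) ≤ 3 ^ k := one_le_pow₀ (by norm_num)
      linarith
    by_contra! hlt
    -- `6/5` lies below `5/4`, absorbing the `-1/4`, yet `(6/5)^4 * 27 > 54`, so `K^4 > 54 Q^3 =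
    -- 2q^3`.
    have h12 : 6 / 5 * Q ≤ 3 * Q - 1 - 3 * n := by linarith
    have h4 := pow_le_pow_left₀ (by linarith) h12 4
    have hQ3 : 27 * Q ^ 3 ≤ Q ^ 4 := by
      rw [pow_succ Q 3, mul_comm]
      exact mul_le_mul_of_nonneg_left hQ27 (by positivity)
    nlinarith [sq_nonneg Q]
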